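/- Let $G$ be a finite group. A generating set $X$ of $G$ is called minimal if no proper subset of $X$ generates $G$; let $d(G)$ and $m(G)$ be the smallest and the largest cardinality of a minimal generating set of $G$. Let $\Gamma(G)$ be the graph whose vertices are the elements of $G$ and in which two vertices $x \neq y$ are adjacent if and only if some minimal generating set of $G$ contains both $x$ and $y$; for an integer $u \geq 0$ let $\Gamma_u(G)$ be the graph on the same vertices in which $x \neq y$ are adjacent if and only if some minimal generating set of $G$ of cardinality $u$ contains both $x$ and $y$. Let $V(G)$ and $V_u(G)$ be the sets of non-isolated vertices of $\Gamma(G)$ and $\Gamma_u(G)$, respectively, and let $$W(G)=\bigcap_{d(G)\leq u\leq m(G)}V_u(G).$$ **Proposition.** Let $G$ be a finite soluble group. If $V(G)=W(G)$, then $d(G)=m(G)$. -/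

import Mathlib

namespace IndependenceGraph

/-- `X` is a minimal generating set of `G`: it generates `G` and no proper subset generates `G`. -/
def IsMinGenSet (G : Type*) [Group G] (X : Set G) : Prop :=
  Subgroup.closure X = ⊤ ∧ ∀ Y : Set G, Y ⊂ X → Subgroup.closure Y ≠ ⊤

/-- `Γ(G)`, the independence graph of `G`. -/
def graph (G : Type*) [Group G] : SimpleGraph G where
  Adj x y := x ≠ y ∧ ∃ X : Set G, IsMinGenSet G X ∧ x ∈ X ∧ y ∈ X
  symm := ⟨fun _ _ ⟨h, X, hX, hx, hy⟩ => ⟨h.symm, X, hX, hy, hx⟩⟩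
  loopless := ⟨fun _ h => h.1 rfl⟩

/-- `Γ_u(G)`: as `Γ(G)`, but only minimal generating sets with exactly `u` elements are used. -/
def graphOfSize (G : Type*) [Group G] (u : ℕ) : SimpleGraph G where
  Adj x y := x ≠ y ∧ ∃ X : Set G, IsMinGenSet G X ∧ X.Finite ∧ X.ncard = u ∧ x ∈ X ∧ y ∈ X
  symm := ⟨fun _ _ ⟨h, X, hX, hf, hu, hx, hy⟩ => ⟨h.symm, X, hX, hf, hu, hy, hx⟩⟩
  loopless := ⟨fun _ h => h.1 rfl⟩

/-- `V(G)`, the set of non-isolated vertices of `Γ(G)`. -/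
def V (G : Type*) [Group G] : Set G := {g | ¬ (graph G).IsIsolated g}

/-- `V_u(G)`, the set of non-isolated vertices of `Γ_u(G)`. -/
def VOfSize (G : Type*) [Group G] (u : ℕ) : Set G := {g | ¬ (graphOfSize G u).IsIsolated g}

/-- The cardinalities of the (finite) minimal generating sets of `G`. For a finite group this set
of natural numbers is non-empty and bounded above by the order of `G`. -/
def minGenSizes (G : Type*) [Group G] : Set ℕ :=
  {n | ∃ X : Set G, IsMinGenSet G X ∧ X.Finite ∧ X.ncard = n}

/-- `d(G)`, the smallest cardinality of a minimal generating set of the finite group `G`. -/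
noncomputable def d (G : Type*) [Group G] : ℕ := sInf (minGenSizes G)

/-- `m(G)`, the largest cardinality of a minimal generating set of the finite group `G`. -/
noncomputable def m (G : Type*) [Group G] : ℕ := sSup (minGenSizes G)

/-- `W(G)`, the intersection of the sets `V_u(G)` for `d(G) ≤ u ≤ m(G)`. -/
def W (G : Type*) [Group G] : Set G := ⋂ u ∈ Set.Icc (d G) (m G), VOfSize G u

end IndependenceGraph

/-!
For an element `x` whose normal closure `N` is abelian, a minimal generating set of `G` containing
`x` remains, after removal of `x`, a minimal generating set modulo `N`; see
`closure_insert_eq_top`. The argument plays this fact off against the smallest and the largest size.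

Suppose that `V(G) = W(G)` and `d(G) < m(G)`. Then `G` is not cyclic, so `V(G)` consists of the
elements outside the Frattini subgroup (`mem_V_of_notMem_frattini`), and each of these lies in a
minimal generating set of size `d(G)` and in one of size `m(G)`. Both properties pass to the Frattini
quotient, so the Frattini subgroup may be taken to be trivial. Then abelian normal subgroups are
complemented, and a maximal abelian normal subgroup `B` is its own centralizer
(`exists_complemented_self_centralizing`).

* The size `m(G)` forces the normal closure of every non-trivial element `x` of `B` to be minimal
  normal: if it were a product `M × M'`, then `x` could be traded for an element of `M` and one of
  `M'` (`isMinNormal_normalClosure`).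
* Consequently `B` has a cyclic complement (`exists_cyclic_complement`). If `B` is not minimal
  normal, the ring of endomorphisms of `B` generated by `G` is a finite domain, hence a field, and a
  complement embeds in its group of units (`isCyclic_of_normalClosure_ne`). If `B` is minimal
  normal, the size `d(G)` shows that `G / B` is generated by `e = d(G) - 1` elements. All `|B| ^ e`
  ways to lift these to `G` generate complements of `B`, which are conjugate by a Sylow argument
  (`exists_conj_of_complements`); hence `|B| ^ e ≤ |B|` and `e ≤ 1`.
* Let `k` generate a cyclic complement. All normal closures of non-trivial elements of `B` have the
  same order `q`, and a minimal generating set containing `k ≠ 1` has `1 + log_q |B|` elements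
  (`card_eq_pow_of_insert`). Since `k` lies in such sets of sizes `d(G)` and `m(G)`, these agree.
  If `k = 1`, then `G = B` and every minimal generating set has `log_q |B|` elements.
-/

open Subgroup

namespace IndependenceGraph

variable {G : Type*} [Group G]

/-! ### Minimal generating sets -/

lemma isMinGenSet_iff {X : Set G} :
    IsMinGenSet G X ↔ closure X = ⊤ ∧ ∀ x ∈ X, closure (X \ {x}) ≠ ⊤ := by
  refine and_congr_right fun _ => ⟨fun h x hx => h _ ?_, fun h Y hY hYt => ?_⟩
  · exact Set.sdiff_singleton_ssubset.2 hx
  · obtain ⟨x, hxX, hxY⟩ := Set.exists_of_ssubset hY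
    refine h x hxX (top_le_iff.1 (hYt ▸ Subgroup.closure_mono fun y hy => ⟨hY.1 hy, ?_⟩))
    rintro rfl
    exact hxY hy

lemma exists_isMinGenSet_subset [Finite G] {S : Set G} (hS : closure S = ⊤) :
    ∃ X ⊆ S, IsMinGenSet G X := by
  obtain ⟨X, hXS, hX⟩ :=
    exists_minimal_le_of_wellFoundedLT (fun X : Set G => closure X = ⊤) S hS
  exact ⟨X, hXS, hX.prop, fun Y hY hYt => hY.2 (hX.le_of_le hYt hY.1)⟩

lemma ncard_mem_minGenSizes [Finite G] {X : Set G} (hX : IsMinGenSet G X) :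
    X.ncard ∈ minGenSizes G :=
  ⟨X, hX, X.toFinite, rfl⟩

lemma bddAbove_minGenSizes [Finite G] : BddAbove (minGenSizes G) := by
  refine ⟨Nat.card G, ?_⟩
  rintro _ ⟨X, -, -, rfl⟩
  exact Set.ncard_le_card X

lemma minGenSizes_nonempty [Finite G] : (minGenSizes G).Nonempty := by
  obtain ⟨X, -, hX⟩ := exists_isMinGenSet_subset (closure_univ (G := G))
  exact ⟨_, ncard_mem_minGenSizes hX⟩

lemma d_mem [Finite G] : d G ∈ minGenSizes G := Nat.sInf_mem minGenSizes_nonempty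

lemma m_mem [Finite G] : m G ∈ minGenSizes G :=
  Nat.sSup_mem minGenSizes_nonempty bddAbove_minGenSizes

lemma d_le {n : ℕ} (hn : n ∈ minGenSizes G) : d G ≤ n := Nat.sInf_le hn

lemma le_m [Finite G] {n : ℕ} (hn : n ∈ minGenSizes G) : n ≤ m G :=
  le_csSup bddAbove_minGenSizes hn

/-! ### Supplements of normal subgroups -/

lemma exists_mul_of_sup_eq_top {N K : Subgroup G} [N.Normal] (h : N ⊔ K = ⊤) (g : G) :
    ∃ k ∈ K, ∃ n ∈ N, k * n = g := by
  have hg : g ∈ K ⊔ N := by rw [sup_comm, h]; trivial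
  exact mem_sup_of_normal_right.1 hg

/-- Dedekind's law for a normal subgroup `A` and a supplement `K` of it. -/
lemma sup_inf_eq_of_sup_eq_top {A C K : Subgroup G} [A.Normal] (hAC : A ≤ C) (h : A ⊔ K = ⊤) :
    A ⊔ C ⊓ K = C := by
  refine le_antisymm (sup_le hAC inf_le_left) fun c hc => ?_
  obtain ⟨k, hk, a, ha, rfl⟩ := exists_mul_of_sup_eq_top h c
  refine mul_mem (mem_sup_right ⟨?_, hk⟩) (mem_sup_left ha)
  exact (mul_mem_cancel_right (hAC ha)).1 hc

lemma normal_inf_of_sup_eq_top {A N K : Subgroup G} [A.Normal] [N.Normal]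
    (hA : A ≤ centralizer (N : Set G)) (h : A ⊔ K = ⊤) : (N ⊓ K).Normal := by
  refine ⟨fun n hn g => ⟨Normal.conj_mem ‹_› n hn.1 g, ?_⟩⟩
  obtain ⟨k, hk, a, ha, rfl⟩ := exists_mul_of_sup_eq_top h g
  have hc : n * a = a * n := mem_centralizer_iff.1 (hA ha) n hn.1
  have : k * a * n * (k * a)⁻¹ = k * n * k⁻¹ := by
    rw [mul_assoc k a n, ← hc]; group
  rw [this]
  exact K.mul_mem (K.mul_mem hk hn.2) (K.inv_mem hk)

lemma card_sup_of_normal [Finite G] {M N : Subgroup G} [M.Normal] (h : M ⊓ N = ⊥) :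
    Nat.card (M ⊔ N : Subgroup G) = Nat.card M * Nat.card N := by
  rw [← Nat.card_prod]
  refine (Nat.card_congr (Equiv.ofBijective
    (fun p : M × N => (⟨p.1 * p.2, mul_mem (mem_sup_left p.1.2) (mem_sup_right p.2.2)⟩ :
      (M ⊔ N : Subgroup G))) ⟨?_, ?_⟩)).symm
  · exact fun p q hpq => mul_injective_of_disjoint (disjoint_iff.2 h) (congrArg Subtype.val hpq)
  · rintro ⟨x, hx⟩
    obtain ⟨b, hb, k, hk, rfl⟩ := mem_sup_of_normal_left.1 hx
    exact ⟨(⟨b, hb⟩, ⟨k, hk⟩), rfl⟩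

/-- In a finite group with trivial Frattini subgroup every abelian normal subgroup is complemented:
a minimal supplement is a complement. -/
lemma exists_complement_of_frattini_eq_bot [Finite G] (hG : frattini G = ⊥) {N : Subgroup G}
    [N.Normal] (hN : N ≤ centralizer (N : Set G)) : ∃ K, N ⊓ K = ⊥ ∧ N ⊔ K = ⊤ := by
  obtain ⟨K, -, hK⟩ := exists_minimal_le_of_wellFoundedLT (fun K : Subgroup G => N ⊔ K = ⊤) ⊤
    (by simp)
  refine ⟨K, ?_, hK.prop⟩
  have hX := normal_inf_of_sup_eq_top hN hK.prop
  by_contra hne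
  obtain ⟨R, hR, hNR⟩ : ∃ R : Subgroup G, IsCoatom R ∧ ¬ N ⊓ K ≤ R := by
    by_contra! hcon
    have hle : N ⊓ K ≤ frattini G := le_iInf₂ hcon
    rw [hG] at hle
    exact hne (le_bot_iff.1 hle)
  have hsup : N ⊓ K ⊔ R = ⊤ := hR.2 _ (right_lt_sup.2 hNR)
  have hKR : N ⊓ K ⊔ K ⊓ R = K := sup_inf_eq_of_sup_eq_top inf_le_right hsup
  have htop : N ⊔ K ⊓ R = ⊤ := by
    refine top_le_iff.1 (hK.prop.ge.trans (sup_le le_sup_left ?_))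
    exact hKR.ge.trans (sup_le_sup_right inf_le_left _)
  have hle : K ≤ K ⊓ R := hK.le_of_le htop inf_le_left
  exact hNR (inf_le_right.trans (hle.trans inf_le_right))

/-! ### Minimal normal subgroups -/

/-- `N` is a minimal normal subgroup of `G`. -/
structure IsMinNormal (N : Subgroup G) : Prop where
  normal : N.Normal
  ne_bot : N ≠ ⊥
  eq_of_le : ∀ M : Subgroup G, M.Normal → M ≠ ⊥ → M ≤ N → M = N

lemma exists_isMinNormal_le [Finite G] {A : Subgroup G} [A.Normal] (hA : A ≠ ⊥) :
    ∃ N ≤ A, IsMinNormal N := by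
  obtain ⟨N, hN, hmin⟩ := exists_minimal_le_of_wellFoundedLT
    (fun N : Subgroup G => N.Normal ∧ N ≠ ⊥) A ⟨‹_›, hA⟩
  exact ⟨N, hN, hmin.prop.1, hmin.prop.2,
    fun M hM hne hle => le_antisymm hle (hmin.le_of_le ⟨hM, hne⟩ hle)⟩

lemma IsMinNormal.le_centralizer [Group.IsSolvable G] {N : Subgroup G} (hN : IsMinNormal N) :
    N ≤ centralizer (N : Set G) := by
  have := hN.normal
  have hlt := Group.IsSolvable.commutator_lt_of_ne_bot hN.ne_bot
  have hbot : ⁅N, N⁆ = ⊥ := by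
    by_contra hne
    exact hlt.ne (hN.eq_of_le _ inferInstance hne hlt.le)
  exact commutator_eq_bot_iff_le_centralizer.1 hbot

/-- A minimal normal subgroup of a finite soluble group is a `p`-group: the elements of order
dividing `p` in it form a normal subgroup. -/
lemma IsMinNormal.exists_isPGroup [Finite G] [Group.IsSolvable G] {N : Subgroup G}
    (hN : IsMinNormal N) : ∃ p : ℕ, p.Prime ∧ IsPGroup p N := by
  have := hN.normal
  have hcard : Nat.card N ≠ 1 := fun h => hN.ne_bot (card_eq_one.1 h)
  obtain ⟨p, hp, hpN⟩ := Nat.exists_prime_and_dvd hcard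
  have := Fact.mk hp
  refine ⟨p, hp, ?_⟩
  let T : Subgroup G :=
    { carrier := {x | x ∈ N ∧ x ^ p = 1}
      one_mem' := ⟨one_mem _, one_pow _⟩
      mul_mem' := by
        rintro a b ⟨ha, ha'⟩ ⟨hb, hb'⟩
        have hc : Commute b a := mem_centralizer_iff.1 (hN.le_centralizer ha) b hb
        exact ⟨mul_mem ha hb, by rw [hc.symm.mul_pow, ha', hb', one_mul]⟩
      inv_mem' := by
        rintro a ⟨ha, ha'⟩
        exact ⟨inv_mem ha, by rw [inv_pow, ha', inv_one]⟩ }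
  have hT : T.Normal := ⟨fun x hx g => ⟨Normal.conj_mem ‹_› x hx.1 g, by
    rw [conj_pow, hx.2, mul_one, mul_inv_cancel]⟩⟩
  have hne : T ≠ ⊥ := by
    obtain ⟨x, hx⟩ := exists_prime_orderOf_dvd_card' p hpN
    intro h
    have hxT : (x : G) ∈ T := ⟨x.2, by
      rw [← Subgroup.coe_pow, ← hx, pow_orderOf_eq_one, Subgroup.coe_one]⟩
    rw [h, mem_bot] at hxT
    have : x = 1 := Subtype.ext hxT
    rw [this, orderOf_one] at hx
    exact hp.one_lt.ne hx
  have hTN : T = N := hN.eq_of_le T hT hne fun x hx => hx.1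
  intro x
  have hx : (x : G) ∈ T := hTN.symm ▸ x.2
  exact ⟨1, Subtype.ext (by simpa using hx.2)⟩

/-! ### Elements with abelian normal closure -/

lemma normalClosure_singleton_ne_bot {x : G} (hx : x ≠ 1) : normalClosure {x} ≠ ⊥ := fun h =>
  hx (mem_bot.1 (h ▸ subset_normalClosure rfl))

/-- Generating `G` modulo an abelian normal closure of `x` amounts to generating it together with
`x`: the normal closure can be formed inside any supplement of it. -/
lemma closure_insert_eq_top {x : G} {Y : Set G}
    (hab : normalClosure {x} ≤ centralizer (normalClosure {x} : Set G))
    (hY : normalClosure {x} ⊔ closure Y = ⊤) : closure (insert x Y) = ⊤ := by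
  have hle : closure Y ≤ closure (insert x Y) := Subgroup.closure_mono (Set.subset_insert x Y)
  have hsup : normalClosure {x} ⊔ closure (insert x Y) = ⊤ :=
    top_le_iff.1 (hY ▸ sup_le_sup_left hle _)
  have hn := normal_inf_of_sup_eq_top hab hsup
  have hx : normalClosure {x} ≤ normalClosure {x} ⊓ closure (insert x Y) :=
    normalClosure_le_normal (Set.singleton_subset_iff.2
      ⟨subset_normalClosure rfl, subset_closure (Set.mem_insert x Y)⟩)
  exact top_le_iff.1 (hsup ▸ sup_le (hx.trans inf_le_right) le_rfl)

/-- If `Y` generates `G` irredundantly modulo an abelian normal subgroup which is the direct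
product of non-trivial normal subgroups `M` and `M'`, then `Y`, moved into a complement, extends to
a minimal generating set with at least two more elements, one from `M` and one from `M'`. -/
lemma exists_isMinGenSet_ncard_add_two_le [Finite G] {N M M' K : Subgroup G} [N.Normal] [M.Normal]
    [M'.Normal] (hNK : N ⊓ K = ⊥) (hNK' : N ⊔ K = ⊤) (hM : M ≠ ⊥) (hM' : M' ≠ ⊥)
    (hMM' : M ⊓ M' = ⊥) (hsup : M ⊔ M' = N) {Y : Set G} (hY : N ⊔ closure Y = ⊤)
    (hYmin : ∀ y ∈ Y, N ⊔ closure (Y \ {y}) ≠ ⊤) :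
    ∃ X, IsMinGenSet G X ∧ Y.ncard + 2 ≤ X.ncard := by
  choose f hfK n hn hfn using exists_mul_of_sup_eq_top hNK'
  have key : ∀ Z : Set G, N ⊔ closure (f '' Z) = N ⊔ closure Z := by
    intro Z
    apply le_antisymm
    · refine sup_le le_sup_left ((closure_le _).2 ?_)
      rintro _ ⟨z, hz, rfl⟩
      rw [eq_mul_inv_of_mul_eq (hfn z)]
      exact mul_mem (mem_sup_right (subset_closure hz)) (mem_sup_left (inv_mem (hn z)))
    · refine sup_le le_sup_left ((closure_le _).2 fun z hz => ?_)
      rw [← hfn z]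
      exact mul_mem (mem_sup_right (subset_closure ⟨z, hz, rfl⟩)) (mem_sup_left (hn z))
  have hYmin' : ∀ Z ⊆ Y, N ⊔ closure Z = ⊤ → Z = Y := by
    intro Z hZ htop
    refine hZ.antisymm fun y hy => by_contra fun hyZ => hYmin y hy (top_le_iff.1 (htop.ge.trans ?_))
    exact sup_le_sup_left (Subgroup.closure_mono (Set.subset_sdiff_singleton hZ hyZ)) _
  have hinj : Set.InjOn f Y := by
    intro y hy y' hy' hyy'
    by_contra hne
    refine hYmin y hy (top_le_iff.1 (hY.ge.trans ?_))
    rw [← key Y, ← key (Y \ {y})]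
    refine sup_le_sup_left (Subgroup.closure_mono ?_) _
    rintro _ ⟨z, hz, rfl⟩
    by_cases h : z = y
    · exact ⟨y', ⟨hy', fun h' => hne h'.symm⟩, by rw [h, hyy']⟩
    · exact ⟨z, ⟨hz, h⟩, rfl⟩
  obtain ⟨X, hXS, hX⟩ := exists_isMinGenSet_subset (S := f '' Y ∪ (M ∪ M' : Set G)) (by
    refine top_le_iff.1 (hY ▸ key Y ▸ sup_le ?_ (Subgroup.closure_mono Set.subset_union_left))
    rw [← hsup]
    refine sup_le ?_ ?_
    · exact fun x hx => subset_closure (Or.inr (Or.inl hx))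
    · exact fun x hx => subset_closure (Or.inr (Or.inr hx)))
  -- Modulo `N` only the elements of `f '' Y` matter, so all of them survive.
  have hfX : f '' Y ⊆ X := by
    have h1 : N ⊔ closure (f '' {y ∈ Y | f y ∈ X}) = ⊤ := by
      refine top_le_iff.1 (hX.1 ▸ (closure_le _).2 fun x hx => ?_)
      rcases hXS hx with ⟨y, hy, rfl⟩ | h | h
      · exact mem_sup_right (subset_closure ⟨y, ⟨hy, hx⟩, rfl⟩)
      · exact mem_sup_left (hsup ▸ mem_sup_left h)
      · exact mem_sup_left (hsup ▸ mem_sup_right h)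
    rw [key] at h1
    have h2 := hYmin' _ (Set.sep_subset _ _) h1
    rintro _ ⟨y, hy, rfl⟩
    rw [← h2] at hy
    exact hy.2
  have hfYK : f '' Y ⊆ K := by
    rintro _ ⟨y, -, rfl⟩
    exact hfK y
  -- A proper direct factor of `N` does not generate `G` together with the complement `K`.
  have hproper : ∀ A A' : Subgroup G, A.Normal → A ⊓ A' = ⊥ → A ≤ N → A' ≤ N → A' ≠ ⊥ →
      ∃ x ∈ X, x ∉ f '' Y ∧ x ∉ A := by
    intro A A' hA hAA' hAN hA'N hA'
    by_contra! hcon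
    have htop : A ⊔ K = ⊤ := by
      refine top_le_iff.1 (hX.1 ▸ (closure_le _).2 fun x hx => ?_)
      by_cases hxf : x ∈ f '' Y
      · exact mem_sup_right (hfYK hxf)
      · exact mem_sup_left (hcon x hx hxf)
    have hN : A = N := by
      rw [← sup_inf_eq_of_sup_eq_top hAN htop, hNK, sup_bot_eq]
    rw [hN, inf_eq_right.2 hA'N] at hAA'
    exact hA' hAA'
  have hMN : M ≤ N := hsup ▸ le_sup_left
  have hMN' : M' ≤ N := hsup ▸ le_sup_right
  obtain ⟨x, hxX, hxf, hxM⟩ := hproper M M' ‹_› hMM' hMN hMN' hM'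
  obtain ⟨y, hyX, hyf, hyM⟩ := hproper M' M ‹_› (inf_comm M M' ▸ hMM') hMN' hMN hM
  have hxy : x ≠ y := by
    rintro rfl
    rcases hXS hxX with h | h | h
    exacts [hxf h, hxM h, hyM h]
  refine ⟨X, hX, ?_⟩
  have hsub : insert x (insert y (f '' Y)) ⊆ X :=
    Set.insert_subset hxX (Set.insert_subset hyX hfX)
  have hcard := Set.ncard_le_ncard hsub X.toFinite
  rw [Set.ncard_insert_of_notMem (by simpa [hxy] using hxf) (Set.toFinite _),
    Set.ncard_insert_of_notMem hyf (Set.toFinite _), hinj.ncard_image] at hcard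
  exact hcard

/-- In a group with trivial Frattini subgroup, an abelian normal closure of an element of a
largest minimal generating set is a minimal normal subgroup: otherwise it is a proper direct
product, and trading the element for one element from each factor enlarges the set. -/
lemma isMinNormal_normalClosure [Finite G] (hG : frattini G = ⊥) {x : G} (hx : x ≠ 1)
    (hab : normalClosure {x} ≤ centralizer (normalClosure {x} : Set G)) {X : Set G}
    (hX : IsMinGenSet G X) (hxX : x ∈ X) (hmax : ∀ n ∈ minGenSizes G, n ≤ X.ncard) :
    IsMinNormal (normalClosure {x}) := by
  refine ⟨inferInstance, normalClosure_singleton_ne_bot hx, fun M hM hMne hle => ?_⟩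
  by_contra hne
  obtain ⟨K, hNK, hNK'⟩ := exists_complement_of_frattini_eq_bot hG hab
  obtain ⟨K₀, hMK, hMK'⟩ := exists_complement_of_frattini_eq_bot hG (N := M)
    (hle.trans (hab.trans (centralizer_le hle)))
  have hsup : M ⊔ normalClosure {x} ⊓ K₀ = normalClosure {x} := sup_inf_eq_of_sup_eq_top hle hMK'
  have hn : (normalClosure {x} ⊓ K₀).Normal := normal_inf_of_sup_eq_top (hle.trans hab) hMK'
  obtain ⟨X', hX', hcard⟩ := exists_isMinGenSet_ncard_add_two_le (Y := X \ {x}) hNK hNK' hMne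
    (M' := normalClosure {x} ⊓ K₀)
    (fun h => hne (by rwa [h, sup_bot_eq] at hsup))
    (le_bot_iff.1 (hMK ▸ inf_le_inf_left _ inf_le_right)) hsup
    (top_le_iff.1 (hX.1 ▸ (closure_le _).2 fun y hy => by
      by_cases h : y = x
      · exact mem_sup_left (h ▸ subset_normalClosure rfl)
      · exact mem_sup_right (subset_closure ⟨hy, h⟩)))
    (fun y hy htop => (isMinGenSet_iff.1 hX).2 y hy.1 (top_le_iff.1
      (closure_insert_eq_top hab htop ▸ Subgroup.closure_mono (by
        rintro z (rfl | hz)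
        · exact ⟨hxX, fun h => hy.2 h.symm⟩
        · exact ⟨hz.1.1, hz.2⟩))))
  have h1 := hmax _ (ncard_mem_minGenSizes hX')
  have h2 := Set.ncard_sdiff_singleton_add_one hxX X.toFinite
  omega

/-! ### Complements of a self-centralizing minimal normal subgroup -/

lemma card_mul_card_inf_of_sup_eq_top [Finite G] {B K L : Subgroup G} [B.Normal] (hBL : B ≤ L)
    (hinf : B ⊓ K = ⊥) (hsup : B ⊔ K = ⊤) :
    Nat.card B * Nat.card (L ⊓ K : Subgroup G) = Nat.card L := by
  have h := sup_inf_eq_of_sup_eq_top hBL hsup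
  have hb : B ⊓ (L ⊓ K) = ⊥ := le_bot_iff.1 (hinf ▸ inf_le_inf_left _ inf_le_right)
  rw [← card_sup_of_normal hb, h]

/-- A normal `p`-subgroup centralizes every minimal normal `p`-subgroup, since its fixed points
there form a non-trivial normal subgroup. -/
lemma IsMinNormal.le_centralizer_of_isPGroup [Finite G] {B L : Subgroup G} (hB : IsMinNormal B)
    [hL : L.Normal] {p : ℕ} [Fact p.Prime] (hBp : IsPGroup p B) (hLp : IsPGroup p L) :
    B ≤ centralizer (L : Set G) := by
  have := hB.normal
  let φ : L →* MulAut B := MulAut.conjNormal.comp L.subtype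
  let : MulAction L B := MulAction.compHom B φ
  have hsmul : ∀ (l : L) (b : B), ((l • b : B) : G) = l * b * (l : G)⁻¹ := fun l b =>
    MulAut.conjNormal_apply _ _
  have hdvd : p ∣ Nat.card B := by
    refine hBp.card_eq_or_dvd.resolve_left fun h => hB.ne_bot (card_eq_one.1 h)
  obtain ⟨b, hb, hb1⟩ := hLp.exists_fixed_point_of_prime_dvd_card_of_fixed_point B hdvd
    (a := 1) (fun l => Subtype.ext (by rw [hsmul]; simp))
  have hmem : (b : G) ∈ B ⊓ centralizer (L : Set G) := by
    refine ⟨b.2, mem_centralizer_iff.2 fun l hl => ?_⟩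
    have h1 := congrArg Subtype.val (hb ⟨l, hl⟩)
    rw [hsmul] at h1
    exact mul_inv_eq_iff_eq_mul.1 h1
  have hne : B ⊓ centralizer (L : Set G) ≠ ⊥ := fun h => hb1 (by
    rw [h, mem_bot] at hmem
    exact (Subtype.ext hmem).symm)
  exact inf_eq_left.1 (hB.eq_of_le _ inferInstance hne inf_le_left)

/-- In a finite soluble group any two complements of a self-centralizing minimal normal subgroup `B`
are conjugate under `B`. If `B` is a `p`-group and `Q` a minimal normal subgroup of a complement
`K`, then `Q` is a Sylow subgroup of `BQ` for a prime other than `p` and `K` is its normalizer. -/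
lemma exists_conj_of_complements [Finite G] [Group.IsSolvable G] {B K K' : Subgroup G}
    (hB : IsMinNormal B) (hcent : centralizer (B : Set G) ≤ B) (hinf : B ⊓ K = ⊥)
    (hsup : B ⊔ K = ⊤) (hinf' : B ⊓ K' = ⊥) (hsup' : B ⊔ K' = ⊤) :
    ∃ b ∈ B, ∀ x ∈ K', b⁻¹ * x * b ∈ K := by
  have := hB.normal
  rcases eq_or_ne K ⊥ with rfl | hK
  · rw [sup_bot_eq] at hsup
    rw [hsup, top_inf_eq] at hinf'
    refine ⟨1, one_mem _, fun x hx => ?_⟩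
    rw [hinf', mem_bot] at hx
    simp [hx]
  obtain ⟨p, hp, hBp⟩ := hB.exists_isPGroup
  obtain ⟨M, -, hM⟩ := exists_isMinNormal_le (G := K) (A := ⊤) (fun h => hK (by
    rw [← card_eq_one, ← card_top (G := K), h, card_bot]))
  obtain ⟨q, hq, hMq⟩ := hM.exists_isPGroup
  have := Fact.mk hp
  have := Fact.mk hq
  have hMn := hM.normal
  set Q : Subgroup G := M.map K.subtype
  have hQK : Q ≤ K := map_subtype_le M
  have hQne : Q ≠ ⊥ := fun h => hM.ne_bot ((map_eq_bot_iff_of_injective M K.subtype_injective).1 h)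
  have hQq : IsPGroup q Q := hMq.map _
  have hQconj : ∀ k ∈ K, ∀ x ∈ Q, k * x * k⁻¹ ∈ Q := by
    rintro k hk _ ⟨x, hx, rfl⟩
    exact ⟨⟨k, hk⟩ * x * ⟨k, hk⟩⁻¹, hMn.conj_mem x hx _, rfl⟩
  have hQcent : ¬ Q ≤ centralizer (B : Set G) := fun h =>
    hQne (le_bot_iff.1 (hinf ▸ le_inf (h.trans hcent) hQK))
  set L : Subgroup G := B ⊔ Q
  have hBL : B ≤ L := le_sup_left
  have hQL : Q ≤ L := le_sup_right
  have hL : L.Normal := by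
    refine ⟨fun l hl g => ?_⟩
    obtain ⟨k, hk, b, hb, rfl⟩ := exists_mul_of_sup_eq_top hsup g
    have h1 : b * l * b⁻¹ ∈ L := mul_mem (mul_mem (hBL hb) hl) (inv_mem (hBL hb))
    obtain ⟨c, hc, x, hx, hcx⟩ := mem_sup_of_normal_left.1 h1
    have h2 : k * b * l * (k * b)⁻¹ = (k * c * k⁻¹) * (k * x * k⁻¹) := by
      rw [show k * b * l * (k * b)⁻¹ = k * (b * l * b⁻¹) * k⁻¹ by group, ← hcx]; group
    rw [h2]
    exact mul_mem (hBL (Normal.conj_mem ‹_› c hc k)) (hQL (hQconj k hk x hx))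
  have hpq : p ≠ q := by
    rintro rfl
    have hLp : IsPGroup p L := hBp.to_sup_of_normal_left hQq
    exact hQcent (hQL.trans (le_centralizer_iff.1 (hB.le_centralizer_of_isPGroup hBp hLp)))
  have hLK : L ⊓ K = Q := by
    refine le_antisymm (fun x hx => ?_) (le_inf hQL hQK)
    obtain ⟨c, hc, y, hy, rfl⟩ := mem_sup_of_normal_left.1 hx.1
    have hcK : c ∈ B ⊓ K := ⟨hc, (K.mul_mem_cancel_right (hQK hy)).1 hx.2⟩
    rw [hinf, mem_bot] at hcK
    simpa [hcK] using hy
  set Q' : Subgroup G := L ⊓ K'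
  have hcard : Nat.card Q' = Nat.card Q := by
    have h1 := card_mul_card_inf_of_sup_eq_top hBL hinf hsup
    have h2 := card_mul_card_inf_of_sup_eq_top hBL hinf' hsup'
    rw [hLK] at h1
    exact Nat.eq_of_mul_eq_mul_left Nat.card_pos (h2.trans h1.symm)
  have hfact : Nat.card Q = q ^ (Nat.card L).factorization q := by
    obtain ⟨a, ha⟩ := IsPGroup.iff_card.1 hBp
    obtain ⟨c, hc⟩ := IsPGroup.iff_card.1 hQq
    have h1 := card_mul_card_inf_of_sup_eq_top hBL hinf hsup
    rw [hLK, ha, hc] at h1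
    rw [← h1, hc, Nat.factorization_mul (pow_ne_zero _ hp.ne_zero) (pow_ne_zero _ hq.ne_zero),
      hp.factorization_pow, hq.factorization_pow]
    simp [hpq]
  -- `Q` and `Q'` are Sylow subgroups of `L`, hence conjugate under `L`.
  let S : Sylow q L := Sylow.ofCard (Q.subgroupOf L) (by
    rw [Nat.card_congr (subgroupOfEquivOfLe hQL).toEquiv, hfact])
  let S' : Sylow q L := Sylow.ofCard (Q'.subgroupOf L) (by
    rw [Nat.card_congr (subgroupOfEquivOfLe (inf_le_left : Q' ≤ L)).toEquiv, hcard, hfact])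
  obtain ⟨l, hl⟩ := MulAction.exists_smul_eq L S S'
  have hmem : ∀ x : L, (l * x * l⁻¹ : G) ∈ Q' ↔ (x : G) ∈ Q := by
    intro x
    have h1 : l * x * l⁻¹ ∈ (S' : Subgroup L) ↔ x ∈ (S : Subgroup L) := by
      rw [← hl, Sylow.coe_subgroup_smul, ← MulAut.conj_apply]
      exact smul_mem_pointwise_smul_iff (a := MulAut.conj l) (S := (S : Subgroup L)) (x := x)
    exact h1
  -- `K` is the normalizer of `Q`.
  have hnorm : ∀ z : G, (∀ x ∈ Q, z * x * z⁻¹ ∈ Q) → z ∈ K := by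
    have hN : (B ⊓ normalizer (Q : Set G)).Normal := by
      refine normal_inf_of_sup_eq_top (A := B) hB.le_centralizer (top_le_iff.1 (hsup ▸ ?_))
      refine sup_le_sup_left (fun k hk => mem_normalizer_iff.2 fun x =>
        ⟨hQconj k hk x, fun h => ?_⟩) _
      have h2 := hQconj k⁻¹ (inv_mem hk) _ h
      rwa [show k⁻¹ * (k * x * k⁻¹) * k⁻¹⁻¹ = x by group] at h2
    have hbot : B ⊓ normalizer (Q : Set G) = ⊥ := by
      by_contra hne
      have hBN : B ≤ normalizer (Q : Set G) := inf_eq_left.1 (hB.eq_of_le _ hN hne inf_le_left)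
      refine hQcent fun x hx => mem_centralizer_iff.2 fun b hb => ?_
      have h1 : b * x * b⁻¹ * x⁻¹ ∈ B ⊓ K := by
        refine ⟨?_, K.mul_mem (hQK ((mem_normalizer_iff.1 (hBN hb) x).1 hx)) (inv_mem (hQK hx))⟩
        rw [mul_assoc, mul_assoc, ← mul_assoc x]
        exact mul_mem hb (Normal.conj_mem ‹_› _ (inv_mem hb) x)
      rw [hinf, mem_bot] at h1
      exact mul_inv_eq_iff_eq_mul.1 (mul_inv_eq_one.1 h1)
    intro z hz
    obtain ⟨k, hk, b, hb, rfl⟩ := exists_mul_of_sup_eq_top hsup z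
    have hbQ : ∀ x ∈ Q, b * x * b⁻¹ ∈ Q := fun x hx => by
      have h2 := hQconj k⁻¹ (inv_mem hk) _ (hz x hx)
      rwa [show k⁻¹ * (k * b * x * (k * b)⁻¹) * k⁻¹⁻¹ = b * x * b⁻¹ by group] at h2
    have hb' : b ∈ B ⊓ normalizer (Q : Set G) := ⟨hb, by
      exact mem_normalizer_fintype hbQ⟩
    rw [hbot, mem_bot] at hb'
    simpa [hb'] using hk
  obtain ⟨b, hb, k, hk, hbk⟩ : ∃ b ∈ B, ∃ k ∈ K, b * k = (l : G) := by
    obtain ⟨b, hb, k, hk, h⟩ := mem_sup_of_normal_left.1 l.2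
    exact ⟨b, hb, k, hQK hk, h⟩
  refine ⟨b, hb, fun x hx => ?_⟩
  have hz : (l : G)⁻¹ * x * l ∈ K := by
    refine hnorm _ fun y hy => ?_
    have h1 := (hmem ⟨y, hQL hy⟩).2 hy
    have h2 : x * (l * y * (l : G)⁻¹) * x⁻¹ ∈ Q' :=
      ⟨hL.conj_mem _ h1.1 _, K'.mul_mem (K'.mul_mem hx h1.2) (inv_mem hx)⟩
    refine (hmem ⟨_, hL.conj_mem y (hQL hy) _⟩).1 ?_
    convert h2 using 1
    rw [InvMemClass.coe_inv]
    group
  rw [show b⁻¹ * x * b = k * ((l : G)⁻¹ * x * l) * k⁻¹ by rw [← hbk]; group]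
  exact K.mul_mem (K.mul_mem hk hz) (inv_mem hk)

/-- If `G` cannot be generated by `|Y|` elements but `Y` generates `G` modulo a self-centralizing
minimal normal subgroup `B`, then each of the `|B| ^ |Y|` ways to change the elements of `Y` by
elements of `B` yields another complement of `B`. Complements being conjugate under `B`, there are
at most `|B|` of them. -/
lemma ncard_le_one_of_forall_lt [Finite G] [Group.IsSolvable G] {B : Subgroup G}
    (hB : IsMinNormal B) (hcent : centralizer (B : Set G) ≤ B) {Y : Set G}
    (hY : B ⊔ closure Y = ⊤) (hlt : ∀ n ∈ minGenSizes G, Y.ncard < n) :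
    Y.ncard ≤ 1 ∧ B ⊓ closure Y = ⊥ := by
  have := hB.normal
  let K : (Y → B) → Subgroup G := fun a => closure (Set.range fun y : Y => (y : G) * a y)
  have hsup : ∀ a, B ⊔ K a = ⊤ := by
    refine fun a => top_le_iff.1 (hY.ge.trans (sup_le le_sup_left
      ((closure_le _).2 fun y hy => ?_)))
    rw [← mul_inv_cancel_right y (a ⟨y, hy⟩ : G)]
    exact mul_mem (mem_sup_right (subset_closure ⟨⟨y, hy⟩, rfl⟩))
      (mem_sup_left (inv_mem (a ⟨y, hy⟩).2))
  have hinf : ∀ a, B ⊓ K a = ⊥ := by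
    intro a
    by_contra hne
    have hBK : B ≤ K a := inf_eq_left.1
      (hB.eq_of_le _ (normal_inf_of_sup_eq_top hB.le_centralizer (hsup a)) hne inf_le_left)
    have htop : K a = ⊤ := by rw [← hsup a, sup_eq_right.2 hBK]
    obtain ⟨X, hXS, hX⟩ := exists_isMinGenSet_subset htop
    have h1 := hlt _ (ncard_mem_minGenSizes hX)
    have h2 := Set.ncard_le_ncard hXS (Set.toFinite _)
    have h3 : (Set.range fun y : Y => (y : G) * a y).ncard ≤ Y.ncard := by
      rw [← Set.image_univ, ← Nat.card_coe_set_eq Y, ← Set.ncard_univ]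
      exact Set.ncard_image_le (Set.toFinite _)
    omega
  have hK1 : K 1 = closure Y := by simp [K]
  refine ⟨?_, hK1 ▸ hinf 1⟩
  choose b hbB hb using fun a =>
    exists_conj_of_complements hB hcent (hinf 1) (hsup 1) (hinf a) (hsup a)
  have hinj : Function.Injective fun a => (⟨b a, hbB a⟩ : B) := by
    intro a a' haa'
    have hbb : b a = b a' := congrArg Subtype.val haa'
    funext y
    have h1 := hb a _ (subset_closure ⟨y, rfl⟩)
    have h2 := hb a' _ (subset_closure ⟨y, rfl⟩)
    rw [← hbb] at h2
    have h3 : (b a)⁻¹ * ((a y : G)⁻¹ * a' y) * b a ∈ B ⊓ K 1 := by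
      refine mem_inf.2 ⟨mul_mem (mul_mem (inv_mem (hbB a)) (mul_mem (inv_mem (a y).2) (a' y).2))
        (hbB a), ?_⟩
      have h4 := (K 1).mul_mem ((K 1).inv_mem h1) h2
      rwa [show ((b a)⁻¹ * (y * a y) * b a)⁻¹ * ((b a)⁻¹ * (y * a' y) * b a) =
        (b a)⁻¹ * ((a y : G)⁻¹ * a' y) * b a by group] at h4
    rw [hinf 1, mem_bot, mul_assoc, inv_mul_eq_one, eq_comm, mul_eq_right, inv_mul_eq_one] at h3
    exact Subtype.ext h3
  have hcard := Nat.card_le_card_of_injective _ hinj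
  rw [Nat.card_fun, Nat.card_coe_set_eq] at hcard
  have hB1 : 1 < Nat.card B := B.one_lt_card_iff_ne_bot.2 hB.ne_bot
  exact (Nat.pow_le_pow_iff_right hB1).1 (hcard.trans_eq (pow_one _).symm)

/-! ### Normal subgroups all of whose elements have minimal normal closure -/

/-- A finite group acting faithfully on a finite abelian group is cyclic if every non-zero element of
the ring of endomorphisms generated by the action is injective: that ring is a finite domain, hence
a field. -/
lemma isCyclic_of_injective_addMonoidEnd {A : Type*} [AddCommGroup A] [Finite A] {K : Type*}
    [Group K] [Finite K] [Nontrivial A] (φ : K →* AddMonoid.End A) (hφ : Function.Injective φ)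
    (h : ∀ r ∈ Subring.closure (Set.range φ), ∀ x : A, x ≠ 0 → r x = 0 → r = 0) : IsCyclic K := by
  set R := Subring.closure (Set.range φ)
  have : Finite (AddMonoid.End A) := Finite.of_injective (fun f : AddMonoid.End A => (f : A → A))
    DFunLike.coe_injective
  have : IsDomain R := by
    have : Nontrivial R := by
      obtain ⟨a, ha⟩ := exists_ne (0 : A)
      exact ⟨0, 1, fun h01 => ha (DFunLike.congr_fun (congrArg Subtype.val h01) a).symm⟩
    have : NoZeroDivisors R := by
      refine ⟨fun {r s} hrs => or_iff_not_imp_right.2 fun hs => ?_⟩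
      obtain ⟨a, ha⟩ : ∃ a, (s : AddMonoid.End A) a ≠ 0 := by
        by_contra! hcon
        exact hs (Subtype.ext (AddMonoidHom.ext hcon))
      exact Subtype.ext (h r r.2 _ ha (DFunLike.congr_fun (congrArg Subtype.val hrs) a))
    exact NoZeroDivisors.to_isDomain R
  let _ : CommRing R := { (inferInstance : Ring R) with
    mul_comm := (Finite.isDomain_to_isField R).mul_comm }
  let f : K →* R :=
    { toFun := fun k => ⟨φ k, Subring.subset_closure ⟨k, rfl⟩⟩
      map_one' := Subtype.ext (map_one φ)
      map_mul' := fun a b => Subtype.ext (map_mul φ a b) }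
  exact isCyclic_of_injective_ringHom f fun a b hab => hφ (congrArg Subtype.val hab)

lemma normalClosure_singleton_eq {B : Subgroup G}
    (hmin : ∀ x ∈ B, x ≠ 1 → IsMinNormal (normalClosure {x})) {x y : G} (hx : x ∈ B)
    (hy : y ≠ 1) (h : y ∈ normalClosure {x}) : normalClosure {y} = normalClosure {x} := by
  refine (hmin x hx ?_).eq_of_le _ inferInstance (normalClosure_singleton_ne_bot hy)
    (normalClosure_le_normal (Set.singleton_subset_iff.2 h))
  rintro rfl
  have h1 : normalClosure {(1 : G)} ≤ ⊥ := normalClosure_le_normal (by simp)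
  exact hy (mem_bot.1 (h1 h))

lemma eq_one_of_mem_normalClosure_inf {B : Subgroup G}
    (hmin : ∀ x ∈ B, x ≠ 1 → IsMinNormal (normalClosure {x})) {x y z : G} (hx : x ∈ B)
    (hy : y ∈ B) (hne : normalClosure {x} ≠ normalClosure {y})
    (hzx : z ∈ normalClosure {x}) (hzy : z ∈ normalClosure {y}) : z = 1 := by
  by_contra hz
  exact hne ((normalClosure_singleton_eq hmin hx hz hzx).symm.trans
    (normalClosure_singleton_eq hmin hy hz hzy))

/-- An endomorphism of `B` preserving the normal subgroups of `G` is injective or trivial, provided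
that the non-trivial elements of `B` have minimal normal closure, different from `B`. If it kills
`x`, then it maps `y` and `x * y` to the same element, which for `y` outside the closure of `x` lies
in two distinct minimal normal subgroups. -/
lemma eq_one_of_preserves_normal {B : Subgroup G}
    (hmin : ∀ x ∈ B, x ≠ 1 → IsMinNormal (normalClosure {x}))
    [B.Normal] (hne : ∀ x ∈ B, normalClosure {x} ≠ B) (r : B →* B)
    (hpres : ∀ N : Subgroup G, N.Normal → ∀ x : B, (x : G) ∈ N → (r x : G) ∈ N) {x : B}
    (hx : x ≠ 1) (hrx : r x = 1) : r = 1 := by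
  have hcoe : ∀ z : B, z ≠ 1 → (z : G) ≠ 1 := fun z hz h => hz (Subtype.ext h)
  have hself : ∀ z : B, (r z : G) ∈ normalClosure {(z : G)} :=
    fun z => hpres _ inferInstance z (subset_normalClosure (Set.mem_singleton _))
  have hstep : ∀ x y : B, x ≠ 1 → r x = 1 → (y : G) ∉ normalClosure {(x : G)} → r y = 1 := by
    intro x y hx hrx hy
    have h1 := hself (x * y)
    rw [map_mul, hrx, one_mul] at h1
    have hneq : normalClosure {((x * y : B) : G)} ≠ normalClosure {(y : G)} := by
      intro h
      have h2 : ((x * y : B) : G) ∈ normalClosure {(y : G)} := by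
        rw [← h]
        exact subset_normalClosure (Set.mem_singleton _)
      have hyy : (y : G) ∈ normalClosure {(y : G)} := subset_normalClosure (Set.mem_singleton _)
      have h3 : (x : G) ∈ normalClosure {(y : G)} := by
        rw [Subgroup.coe_mul] at h2
        exact (Subgroup.mul_mem_cancel_right _ hyy).1 h2
      rw [normalClosure_singleton_eq hmin y.2 (hcoe x hx) h3] at hy
      exact hy hyy
    exact Subtype.ext (eq_one_of_mem_normalClosure_inf hmin (x * y).2 y.2 hneq h1 (hself y))
  ext1 y
  by_cases hy : (y : G) ∈ normalClosure {(x : G)}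
  swap
  · exact hstep x y hx hrx hy
  by_cases hy1 : y = 1
  · rw [hy1, map_one, map_one]
  -- Pass through an element outside the common normal closure of `x` and `y`.
  obtain ⟨z, hzB, hz⟩ : ∃ z ∈ B, z ∉ normalClosure {(x : G)} := by
    by_contra! hcon
    exact hne _ x.2 (le_antisymm (normalClosure_le_normal (Set.singleton_subset_iff.2 x.2)) hcon)
  have hz1 : (⟨z, hzB⟩ : B) ≠ 1 := by
    intro h
    have h' : z = 1 := congrArg Subtype.val h
    exact hz (h' ▸ one_mem _)
  refine hstep ⟨z, hzB⟩ y hz1 (hstep x ⟨z, hzB⟩ hx hrx hz) fun h => ?_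
  have h1 := normalClosure_singleton_eq hmin hzB (hcoe y hy1) h
  rw [normalClosure_singleton_eq hmin x.2 (hcoe y hy1) hy] at h1
  exact hz (h1 ▸ subset_normalClosure rfl)

/-- If every non-trivial element of the abelian normal subgroup `B` has minimal normal closure but
`B` itself is not minimal normal, then `G` acts on `B` through a cyclic group. -/
lemma isCyclic_of_normalClosure_ne [Finite G] {B K : Subgroup G} [B.Normal]
    (hab : B ≤ centralizer (B : Set G)) (hcent : centralizer (B : Set G) ≤ B) (hinf : B ⊓ K = ⊥)
    (hmin : ∀ x ∈ B, x ≠ 1 → IsMinNormal (normalClosure {x}))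
    (hne : ∀ x ∈ B, normalClosure {x} ≠ B) : IsCyclic K := by
  let _ : CommGroup B :=
    { (inferInstance : Group B) with
      mul_comm := fun a b => Subtype.ext (mem_centralizer_iff.1 (hab b.2) a a.2) }
  have hBne : B ≠ ⊥ := fun h => hne 1 (one_mem B) (by rw [h]; simp)
  have : Nontrivial B := (nontrivial_iff_ne_bot B).2 hBne
  let φ : K →* AddMonoid.End (Additive B) :=
    { toFun := fun k => (MulAut.conjNormal (H := B) (k : G)).toMonoidHom.toAdditive
      map_one' := by
        rw [OneMemClass.coe_one, map_one]
        rfl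
      map_mul' := fun a b => by
        rw [Subgroup.coe_mul, map_mul]
        rfl }
  have hφ : ∀ (k : K) (x : B), ((φ k (Additive.ofMul x)).toMul : G) = k * x * (k : G)⁻¹ :=
    fun k x => MulAut.conjNormal_apply _ _
  have hinj : Function.Injective φ := by
    refine (injective_iff_map_eq_one φ).2 fun k hk => ?_
    have hkB : (k : G) ∈ B ⊓ K := by
      refine ⟨hcent (mem_centralizer_iff.2 fun b hb => ?_), k.2⟩
      have h1 := hφ k ⟨b, hb⟩
      rw [hk] at h1
      exact (eq_mul_inv_iff_mul_eq.1 h1)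
    rw [hinf, mem_bot] at hkB
    exact Subtype.ext hkB
  refine isCyclic_of_injective_addMonoidEnd φ hinj fun r hr => ?_
  -- The endomorphisms in question preserve the normal subgroups of `G`.
  have hpres : ∀ N : Subgroup G, N.Normal → ∀ x : B, (x : G) ∈ N →
      ((r (Additive.ofMul x)).toMul : G) ∈ N := by
    intro N hN
    induction hr using Subring.closure_induction with
    | mem r hr =>
      obtain ⟨k, rfl⟩ := hr
      intro x hx
      rw [hφ]
      exact hN.conj_mem _ hx _
    | zero => exact fun x _ => N.one_mem
    | one => exact fun x hx => hx
    | add r s _ _ hr hs => exact fun x hx => N.mul_mem (hr x hx) (hs x hx)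
    | neg r _ hr => exact fun x hx => N.inv_mem (hr x hx)
    | mul r s _ _ hr hs => exact fun x hx => hr (s (Additive.ofMul x)).toMul (hs x hx)
  intro x hx hrx
  have h1 := eq_one_of_preserves_normal hmin hne (MonoidHom.toAdditive.symm r) hpres
    (x := x.toMul) hx hrx
  exact MonoidHom.toAdditive.symm.injective h1

/-- The normal closures of the non-trivial elements of `B` have the same order: for distinct
closures of `x` and `y`, that of `x * y` is a diagonal in their product. -/
lemma card_normalClosure_eq [Finite G] {B : Subgroup G}
    (hmin : ∀ x ∈ B, x ≠ 1 → IsMinNormal (normalClosure {x})) {x y : G} (hx : x ∈ B) (hy : y ∈ B)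
    (hx1 : x ≠ 1) (hy1 : y ≠ 1) : Nat.card (normalClosure {x}) = Nat.card (normalClosure {y}) := by
  by_cases hne : normalClosure {x} = normalClosure {y}
  · rw [hne]
  have hxx : x ∈ normalClosure {x} := subset_normalClosure rfl
  have hyy : y ∈ normalClosure {y} := subset_normalClosure rfl
  have hxy : x * y ∈ normalClosure {x * y} := subset_normalClosure rfl
  have hinf : ∀ u ∈ B, ∀ v ∈ B, normalClosure {u} ≠ normalClosure {v} →
      normalClosure {u} ⊓ normalClosure {v} = ⊥ := fun u hu v hv huv =>
    (eq_bot_iff_forall _).2 fun z hz => eq_one_of_mem_normalClosure_inf hmin hu hv huv hz.1 hz.2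
  have hnx : normalClosure {x} ≠ normalClosure {x * y} := by
    intro h
    have hyx : y ∈ normalClosure {x} := (mul_mem_cancel_left hxx).1 (h ▸ hxy)
    exact hy1 (eq_one_of_mem_normalClosure_inf hmin hx hy hne hyx hyy)
  have hny : normalClosure {x * y} ≠ normalClosure {y} := by
    intro h
    have hxy' : x ∈ normalClosure {y} := (mul_mem_cancel_right hyy).1 (h ▸ hxy)
    exact hx1 (eq_one_of_mem_normalClosure_inf hmin hx hy hne hxx hxy')
  have hle : ∀ u : G, ∀ N : Subgroup G, N.Normal → u ∈ N → normalClosure {u} ≤ N :=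
    fun u N _ hu => normalClosure_le_normal (Set.singleton_subset_iff.2 hu)
  have h1 : normalClosure {x} ⊔ normalClosure {x * y} = normalClosure {x} ⊔ normalClosure {y} := by
    refine le_antisymm (sup_le le_sup_left (hle _ _ inferInstance
      (mul_mem (mem_sup_left hxx) (mem_sup_right hyy)))) (sup_le le_sup_left
      (hle _ _ inferInstance ?_))
    exact (mul_mem_cancel_left (mem_sup_left hxx)).1 (mem_sup_right hxy)
  have h2 : normalClosure {x * y} ⊔ normalClosure {y} = normalClosure {x} ⊔ normalClosure {y} := by
    refine le_antisymm (sup_le (hle _ _ inferInstance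
      (mul_mem (mem_sup_left hxx) (mem_sup_right hyy))) le_sup_right) (sup_le
      (hle _ _ inferInstance ?_) le_sup_right)
    exact (mul_mem_cancel_right (mem_sup_right hyy)).1 (mem_sup_left hxy)
  have c0 := card_sup_of_normal (hinf x hx y hy hne)
  have c1 := card_sup_of_normal (hinf x hx _ (mul_mem hx hy) hnx)
  have c2 := card_sup_of_normal (hinf _ (mul_mem hx hy) y hy hny)
  rw [h1, c0] at c1
  rw [h2, c0] at c2
  have e1 := Nat.eq_of_mul_eq_mul_left Nat.card_pos c1
  have e2 := Nat.eq_of_mul_eq_mul_right Nat.card_pos c2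
  rw [e2, e1]

/-- Let `G` be a semidirect product of `B` by the cyclic group generated by `k`, where the
non-trivial elements of `B` have minimal normal closures, of order `q`. A set `X` which together
with `k` generates `G` irredundantly has `log_q |B|` elements: the `B`-parts of its elements have
normal closures whose product is direct and equal to `B`. -/
lemma card_eq_pow_of_insert [Finite G] {B : Subgroup G} [B.Normal] {k : G}
    (hab : B ≤ centralizer (B : Set G)) (hinf : B ⊓ zpowers k = ⊥) (hsup : B ⊔ zpowers k = ⊤)
    (hmin : ∀ x ∈ B, x ≠ 1 → IsMinNormal (normalClosure {x})) {q : ℕ}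
    (hq : ∀ x ∈ B, x ≠ 1 → Nat.card (normalClosure {x}) = q) {X : Set G}
    (hX : closure (insert k X) = ⊤) (hXmin : ∀ x ∈ X, closure (insert k (X \ {x})) ≠ ⊤) :
    Nat.card B = q ^ X.ncard := by
  choose c hc b hb hcb using exists_mul_of_sup_eq_top hsup
  have hle : ∀ Z : Set G, normalClosure (b '' Z) ≤ B := fun Z =>
    normalClosure_le_normal (by rintro _ ⟨z, -, rfl⟩; exact hb z)
  have hkmem : ∀ Z : Set G, zpowers k ≤ closure (insert k Z) := fun Z =>
    zpowers_le.2 (subset_closure (Set.mem_insert k Z))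
  -- As `B` is abelian, normal closures can be formed inside any supplement of `B`.
  have hncl : ∀ Z : Set G, normalClosure (b '' Z) ≤ closure (insert k Z) := by
    intro Z
    have hn : (B ⊓ closure (insert k Z)).Normal := normal_inf_of_sup_eq_top hab
      (top_le_iff.1 (hsup.ge.trans (sup_le_sup_left (hkmem Z) B)))
    refine (normalClosure_le_normal (N := B ⊓ closure (insert k Z)) ?_).trans inf_le_right
    rintro _ ⟨z, hz, rfl⟩
    refine ⟨hb z, ?_⟩
    rw [eq_inv_mul_of_mul_eq (hcb z)]
    exact Subgroup.mul_mem _ (Subgroup.inv_mem _ (hkmem Z (hc z)))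
      (subset_closure (Set.mem_insert_of_mem k hz))
  have hcard : ∀ Z ⊆ X, Nat.card (normalClosure (b '' Z)) = q ^ Z.ncard := by
    intro Z
    induction Z, Set.toFinite Z using Set.Finite.induction_on with
    | empty => intro _; simp
    | @insert x Z hxZ hZ ih =>
      intro hsub
      have hxX : x ∈ X := hsub (Set.mem_insert x Z)
      have hZX : Z ⊆ X := (Set.subset_insert x Z).trans hsub
      have hbx : b x ∉ normalClosure (b '' Z) := by
        intro h
        refine hXmin x hxX (top_le_iff.1 (hX.ge.trans ((closure_le _).2 ?_)))
        have hZx : closure (insert k Z) ≤ closure (insert k (X \ {x})) :=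
          Subgroup.closure_mono (Set.insert_subset_insert (Set.subset_sdiff_singleton hZX hxZ))
        rintro y (rfl | hy)
        · exact subset_closure (Set.mem_insert _ _)
        · by_cases hyx : y = x
          · rw [hyx]
            refine (congrArg (· ∈ closure (insert k (X \ {x}))) (hcb x)).mp ?_
            exact mul_mem (hkmem _ (hc x)) (hZx (hncl Z h))
          · exact subset_closure (Set.mem_insert_of_mem _ ⟨hy, hyx⟩)
      have hbx1 : b x ≠ 1 := fun h => hbx (h ▸ one_mem _)
      have hdisj : normalClosure {b x} ⊓ normalClosure (b '' Z) = ⊥ := by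
        by_contra hne
        have h1 := (hmin _ (hb x) hbx1).eq_of_le _ inferInstance hne inf_le_left
        exact hbx (inf_eq_left.1 h1 (subset_normalClosure rfl))
      have hsupZ : normalClosure (b '' insert x Z) =
          normalClosure {b x} ⊔ normalClosure (b '' Z) := by
        rw [Set.image_insert_eq]
        refine le_antisymm (normalClosure_le_normal ?_) (sup_le
          (normalClosure_mono (Set.singleton_subset_iff.2 (Set.mem_insert _ _)))
          (normalClosure_mono (Set.subset_insert _ _)))
        rintro y (rfl | hy)
        · exact mem_sup_left (subset_normalClosure rfl)
        · exact mem_sup_right (subset_normalClosure hy)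
      rw [hsupZ, card_sup_of_normal hdisj, hq _ (hb x) hbx1, ih hZX,
        Set.ncard_insert_of_notMem hxZ (Set.toFinite Z), pow_succ']
  have htop : normalClosure (b '' X) ⊔ zpowers k = ⊤ := by
    refine top_le_iff.1 (hX.ge.trans ((closure_le _).2 ?_))
    rintro y (rfl | hy)
    · exact mem_sup_right (mem_zpowers _)
    · rw [← hcb y]
      exact mul_mem (mem_sup_right (hc y)) (mem_sup_left (subset_normalClosure ⟨y, hy, rfl⟩))
  have hBX : normalClosure (b '' X) = B := by
    have h := sup_inf_eq_of_sup_eq_top (hle X) htop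
    rwa [hinf, sup_bot_eq] at h
  rw [← hcard X subset_rfl, hBX]

/-! ### Groups with trivial Frattini subgroup -/

/-- A maximal abelian normal subgroup of a finite soluble group with trivial Frattini subgroup is
complemented and equal to its own centralizer. -/
lemma exists_complemented_self_centralizing [Finite G] [Group.IsSolvable G]
    (hG : frattini G = ⊥) : ∃ B K : Subgroup G, B.Normal ∧ B ≤ centralizer (B : Set G) ∧
      centralizer (B : Set G) ≤ B ∧ B ⊓ K = ⊥ ∧ B ⊔ K = ⊤ := by
  obtain ⟨B, -, hB⟩ := exists_maximal_ge_of_wellFoundedGT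
    (fun B : Subgroup G => B.Normal ∧ B ≤ centralizer (B : Set G)) ⊥ ⟨inferInstance, bot_le⟩
  obtain ⟨hn, hab⟩ := hB.prop
  obtain ⟨K, hinf, hsup⟩ := exists_complement_of_frattini_eq_bot hG hab
  refine ⟨B, K, hn, hab, ?_, hinf, hsup⟩
  have hC : (centralizer (B : Set G) ⊓ K).Normal :=
    normal_inf_of_sup_eq_top (A := B) (le_centralizer_iff.1 le_rfl) hsup
  have hbot : centralizer (B : Set G) ⊓ K = ⊥ := by
    by_contra hne
    obtain ⟨N, hNC, hN⟩ := exists_isMinNormal_le hne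
    have := hN.normal
    have hNB : N ≤ centralizer (B : Set G) := hNC.trans inf_le_left
    have hBN : B ⊔ N ≤ centralizer ((B ⊔ N : Subgroup G) : Set G) :=
      sup_le (le_centralizer_iff.1 (sup_le hab hNB))
        (le_centralizer_iff.1 (sup_le (le_centralizer_iff.1 hNB) hN.le_centralizer))
    have hle : N ≤ B := le_sup_right.trans (hB.le_of_ge ⟨inferInstance, hBN⟩ le_sup_left)
    exact hN.ne_bot (le_bot_iff.1 (hinf ▸ le_inf hle (hNC.trans inf_le_right)))
  rw [← sup_inf_eq_of_sup_eq_top hab hsup, hbot, sup_bot_eq]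

/-- The group induced on `B` is cyclic. If `B` is minimal normal, a smallest minimal generating set
containing an element of `B` shows that `G` needs more generators than `G / B`, and the count of
complements applies; otherwise `G` acts on `B` through the units of a finite field. -/
lemma exists_cyclic_complement [Finite G] [Group.IsSolvable G] {B K : Subgroup G} [B.Normal]
    (hab : B ≤ centralizer (B : Set G)) (hcent : centralizer (B : Set G) ≤ B) (hinf : B ⊓ K = ⊥)
    (hsup : B ⊔ K = ⊤) (hB : B ≠ ⊥)
    (hmin : ∀ x ∈ B, x ≠ 1 → IsMinNormal (normalClosure {x}))
    (hd : ∀ x : G, x ≠ 1 → ∃ X, IsMinGenSet G X ∧ x ∈ X ∧ X.ncard = d G) :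
    ∃ k : G, B ⊓ zpowers k = ⊥ ∧ B ⊔ zpowers k = ⊤ := by
  by_cases h : ∃ x ∈ B, normalClosure {x} = B
  · obtain ⟨x, hxB, hx⟩ := h
    have hx1 : x ≠ 1 := by
      rintro rfl
      exact hB (hx ▸ normalClosure_eq_bot_iff.2 subset_rfl)
    obtain ⟨X, hX, hxX, hXd⟩ := hd x hx1
    have hcard := Set.ncard_sdiff_singleton_add_one hxX X.toFinite
    have hgen : B ⊔ closure (X \ {x}) = ⊤ := by
      refine top_le_iff.1 (hX.1.ge.trans ((closure_le _).2 fun y hy => ?_))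
      by_cases hyx : y = x
      · exact mem_sup_left (hyx ▸ hxB)
      · exact mem_sup_right (subset_closure ⟨hy, hyx⟩)
    obtain ⟨hle, hinf'⟩ := ncard_le_one_of_forall_lt (hx ▸ hmin x hxB hx1) hcent hgen
      fun n hn => by have := d_le hn; omega
    rcases (Set.ncard_le_one_iff_subsingleton.1 hle).eq_empty_or_singleton with h0 | ⟨k, hk⟩
    · refine ⟨1, ?_⟩
      rw [h0, Subgroup.closure_empty] at hgen hinf'
      rw [zpowers_one_eq_bot]
      exact ⟨hinf', hgen⟩
    · refine ⟨k, ?_⟩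
      rw [hk, ← zpowers_eq_closure] at hgen hinf'
      exact ⟨hinf', hgen⟩
  · push Not at h
    have hcyc := isCyclic_of_normalClosure_ne hab hcent hinf hmin h
    obtain ⟨k, rfl⟩ := (Subgroup.isCyclic_iff_exists_zpowers_eq_top K).1 hcyc
    exact ⟨k, hinf, hsup⟩

/-- If every non-trivial element lies in a minimal generating set of the smallest size and in one of
the largest size, then both sizes are read off from the order of `B` by completing a generator `k`
of the complement. -/
theorem d_eq_m_of_frattini_eq_bot [Finite G] [Group.IsSolvable G] (hG : frattini G = ⊥)
    (hd : ∀ x : G, x ≠ 1 → ∃ X, IsMinGenSet G X ∧ x ∈ X ∧ X.ncard = d G)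
    (hm : ∀ x : G, x ≠ 1 → ∃ X, IsMinGenSet G X ∧ x ∈ X ∧ X.ncard = m G) : d G = m G := by
  rcases subsingleton_or_nontrivial G with hsub | hnt
  · have h0 : ∀ n ∈ minGenSizes G, n = 0 := by
      rintro _ ⟨X, hX, -, rfl⟩
      refine (Set.ncard_eq_zero X.toFinite).2 (Set.eq_empty_of_forall_notMem fun x hx => ?_)
      exact (isMinGenSet_iff.1 hX).2 x hx (Subsingleton.elim _ _)
    rw [h0 _ d_mem, h0 _ m_mem]
  obtain ⟨B, K, hn, hab, hcent, hinf, hsup⟩ := exists_complemented_self_centralizing hG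
  have hB : B ≠ ⊥ := by
    rintro rfl
    refine (bot_ne_top : (⊥ : Subgroup G) ≠ ⊤) (top_le_iff.1 (le_trans ?_ hcent))
    exact fun x _ => mem_centralizer_iff.2 fun y hy => by
      rw [mem_bot.1 hy, one_mul, mul_one]
  have hmin : ∀ x ∈ B, x ≠ 1 → IsMinNormal (normalClosure {x}) := by
    intro x hx hx1
    have hle : normalClosure {x} ≤ B := normalClosure_le_normal (Set.singleton_subset_iff.2 hx)
    obtain ⟨X, hX, hxX, hXm⟩ := hm x hx1
    exact isMinNormal_normalClosure hG hx1 (hle.trans (hab.trans (centralizer_le hle))) hX hxX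
      fun n hn => hXm ▸ le_m hn
  obtain ⟨k, hkinf, hksup⟩ := exists_cyclic_complement hab hcent hinf hsup hB hmin hd
  obtain ⟨⟨b, hb⟩, hb1⟩ := B.ne_bot_iff_exists_ne_one.1 hB
  have hb1' : b ≠ 1 := fun h => hb1 (Subtype.ext h)
  have hq1 : 1 < Nat.card (normalClosure {b}) :=
    one_lt_card_iff_ne_bot _ |>.2 (normalClosure_singleton_ne_bot hb1')
  have hcard : ∀ X : Set G, closure (insert k X) = ⊤ →
      (∀ x ∈ X, closure (insert k (X \ {x})) ≠ ⊤) →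
      Nat.card B = Nat.card (normalClosure {b}) ^ X.ncard := fun X =>
    card_eq_pow_of_insert hab hkinf hksup hmin
      fun x hx hx1 => card_normalClosure_eq hmin hx hb hx1 hb1'
  -- For `k = 1` the group is `B`, and `k` itself lies in no minimal generating set.
  by_cases hk : k = 1
  · have hins : ∀ Z : Set G, closure (insert k Z) = closure Z := fun Z => by
      rw [hk, closure_insert_one]
    simp only [hins] at hcard
    obtain ⟨X, hX, -, hXd⟩ := hd b hb1'
    obtain ⟨X', hX', -, hXm⟩ := hm b hb1'
    have h1 := hcard X hX.1 (isMinGenSet_iff.1 hX).2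
    rw [hcard X' hX'.1 (isMinGenSet_iff.1 hX').2, hXd, hXm] at h1
    exact (Nat.pow_right_injective hq1 h1).symm
  · have hdel : ∀ X : Set G, IsMinGenSet G X → k ∈ X →
        Nat.card B = Nat.card (normalClosure {b}) ^ (X \ {k}).ncard := by
      intro X hX hkX
      refine hcard (X \ {k}) ?_ fun x hx => ?_
      · rw [Set.insert_sdiff_singleton, Set.insert_eq_of_mem hkX, hX.1]
      · have hset : insert k ((X \ {k}) \ {x}) = X \ {x} := by
          rw [Set.sdiff_sdiff_comm, Set.insert_sdiff_singleton,
            Set.insert_eq_of_mem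
              (show k ∈ X \ {x} from ⟨hkX, fun h => hx.2 h.symm⟩)]
        rw [hset]
        exact (isMinGenSet_iff.1 hX).2 x hx.1
    obtain ⟨X, hX, hkX, hXd⟩ := hd k hk
    obtain ⟨X', hX', hkX', hXm⟩ := hm k hk
    have h1 := hdel X hX hkX
    rw [hdel X' hX' hkX'] at h1
    have h2 := Nat.pow_right_injective hq1 h1
    rw [← hXd, ← hXm, ← Set.ncard_sdiff_singleton_add_one hkX X.toFinite,
      ← Set.ncard_sdiff_singleton_add_one hkX' X'.toFinite, h2]

/-! ### Passage to the Frattini quotient -/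

lemma closure_image_frattini_eq_top_iff [Finite G] {S : Set G} :
    closure (QuotientGroup.mk' (frattini G) '' S) = ⊤ ↔ closure S = ⊤ := by
  rw [← MonoidHom.map_closure]
  refine ⟨fun h => frattini_nongenerating ?_, fun h => ?_⟩
  · rw [← QuotientGroup.ker_mk' (frattini G), ← comap_map_eq, h, comap_top]
  · rw [h, ← MonoidHom.range_eq_map, QuotientGroup.range_mk']

lemma frattini_quotient_frattini [Finite G] : frattini (G ⧸ frattini G) = ⊥ := by
  have hle : (frattini (G ⧸ frattini G)).comap (QuotientGroup.mk' (frattini G)) ≤ frattini G := by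
    refine le_iInf₂ fun M hM => ?_
    by_contra hcon
    have htop := hM.2 _ (left_lt_sup.2 hcon)
    have h1 : M.map (QuotientGroup.mk' (frattini G)) ⊔ frattini (G ⧸ frattini G) = ⊤ := by
      rw [← map_comap_eq_self_of_surjective (QuotientGroup.mk'_surjective (frattini G))
        (frattini (G ⧸ frattini G)), ← Subgroup.map_sup, htop, ← MonoidHom.range_eq_map,
        QuotientGroup.range_mk']
    have h2 := frattini_nongenerating h1
    rw [← closure_eq M, MonoidHom.map_closure, closure_image_frattini_eq_top_iff,
      closure_eq] at h2
    exact hM.1 h2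
  refine (eq_bot_iff_forall _).2 fun x hx => ?_
  obtain ⟨g, rfl⟩ := QuotientGroup.mk'_surjective (frattini G) x
  exact (QuotientGroup.eq_one_iff g).2 (hle hx)

lemma IsMinGenSet.image_frattini [Finite G] {S : Set G} (hS : IsMinGenSet G S) :
    IsMinGenSet (G ⧸ frattini G) (QuotientGroup.mk' (frattini G) '' S) ∧
      (QuotientGroup.mk' (frattini G) '' S).ncard = S.ncard := by
  refine ⟨⟨closure_image_frattini_eq_top_iff.2 hS.1, fun Y hY htop => hY.2 ?_⟩, ?_⟩
  · have hYeq : QuotientGroup.mk' (frattini G) '' (S ∩ QuotientGroup.mk' (frattini G) ⁻¹' Y) = Y := by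
      rw [Set.image_inter_preimage, Set.inter_eq_right.2 hY.1]
    have h1 : S ∩ QuotientGroup.mk' (frattini G) ⁻¹' Y = S := by
      by_contra hne
      refine hS.2 _ (Set.inter_subset_left.ssubset_of_ne hne) ?_
      rw [← closure_image_frattini_eq_top_iff, hYeq, htop]
    rw [h1] at hYeq
    exact hYeq.subset
  · refine Set.InjOn.ncard_image fun y hy y' hy' hyy' => ?_
    by_contra hne
    refine (isMinGenSet_iff.1 hS).2 y hy (closure_image_frattini_eq_top_iff.1 ?_)
    rw [← closure_image_frattini_eq_top_iff.2 hS.1]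
    congr 1
    refine (Set.image_mono Set.sdiff_subset).antisymm ?_
    rintro _ ⟨z, hz, rfl⟩
    by_cases hzy : z = y
    · exact ⟨y', ⟨hy', fun h => hne h.symm⟩, by rw [hzy, hyy']⟩
    · exact ⟨z, ⟨hz, hzy⟩, rfl⟩

lemma minGenSizes_quotient_frattini [Finite G] :
    minGenSizes (G ⧸ frattini G) = minGenSizes G := by
  ext n
  constructor
  · rintro ⟨Z, hZ, -, rfl⟩
    have him : ∀ T : Set (G ⧸ frattini G),
        QuotientGroup.mk' (frattini G) '' (Quotient.out '' T) = T := fun T => by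
      rw [Set.image_image]
      exact (Set.image_congr fun z _ => QuotientGroup.out_eq' z).trans (Set.image_id' T)
    refine ⟨Quotient.out '' Z, ⟨?_, fun Y hY htop => hY.2 ?_⟩, Set.toFinite _,
      Set.ncard_image_of_injective _ Quotient.out_injective⟩
    · rw [← closure_image_frattini_eq_top_iff, him, hZ.1]
    · obtain ⟨T, hT, rfl⟩ := Set.subset_image_iff.1 hY.1
      rw [← closure_image_frattini_eq_top_iff, him] at htop
      have hTZ : T = Z := by_contra fun hne => hZ.2 T (hT.ssubset_of_ne hne) htop
      rw [hTZ]
  · rintro ⟨S, hS, -, rfl⟩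
    exact hS.image_frattini.2 ▸ ncard_mem_minGenSizes hS.image_frattini.1

/-! ### The non-isolated vertices -/

lemma mem_V_iff {x : G} :
    x ∈ V G ↔ ∃ X, IsMinGenSet G X ∧ x ∈ X ∧ ∃ y ∈ X, x ≠ y := by
  simp only [V, SimpleGraph.IsIsolated, graph, Set.mem_ofPred_eq, not_forall, not_not]
  exact ⟨fun ⟨y, hxy, X, hX, hx, hy⟩ => ⟨X, hX, hx, y, hy, hxy⟩,
    fun ⟨X, hX, hx, y, hy, hxy⟩ => ⟨y, hxy, X, hX, hx, hy⟩⟩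

lemma exists_of_mem_VOfSize {x : G} {u : ℕ} (hx : x ∈ VOfSize G u) :
    ∃ X, IsMinGenSet G X ∧ X.ncard = u ∧ x ∈ X ∧ 1 < u := by
  simp only [VOfSize, SimpleGraph.IsIsolated, graphOfSize, Set.mem_ofPred_eq, not_forall,
    not_not] at hx
  obtain ⟨y, hxy, X, hX, hfin, rfl, hxX, hyX⟩ := hx
  exact ⟨X, hX, rfl, hxX, (Set.one_lt_ncard hfin).2 ⟨x, hxX, y, hyX, hxy⟩⟩

/-- In a finite non-cyclic group every element outside the Frattini subgroup is a non-isolated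
vertex: it generates the group together with a maximal subgroup not containing it. -/
lemma mem_V_of_notMem_frattini [Finite G] (hd : 1 < d G) {x : G} (hx : x ∉ frattini G) :
    x ∈ V G := by
  obtain ⟨M, hM, hxM⟩ : ∃ M : Subgroup G, IsCoatom M ∧ x ∉ M := by
    by_contra! hcon
    have hle : zpowers x ≤ frattini G := le_iInf₂ fun M hM => zpowers_le.2 (hcon M hM)
    exact hx (hle (mem_zpowers x))
  have htop : closure (insert x (M : Set G)) = ⊤ := by
    refine hM.2 _ (lt_of_le_of_ne (fun y hy => subset_closure (Or.inr hy)) fun h => hxM ?_)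
    rw [h]
    exact subset_closure (Or.inl rfl)
  obtain ⟨X, hXS, hX⟩ := exists_isMinGenSet_subset htop
  have hxX : x ∈ X := by
    by_contra hcon
    refine hM.1 (top_le_iff.1 (hX.1.ge.trans ((closure_le M).2 fun y hy => ?_)))
    rcases hXS hy with rfl | h
    exacts [absurd hy hcon, h]
  have hcard : 1 < X.ncard := hd.trans_le (d_le (ncard_mem_minGenSizes hX))
  obtain ⟨y, hy, hyx⟩ := Set.exists_ne_of_one_lt_ncard hcard x
  exact mem_V_iff.2 ⟨X, hX, hxX, y, hy, hyx.symm⟩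

theorem d_eq_m_of_V_eq_W [Finite G] [Group.IsSolvable G] (h : V G = W G) : d G = m G := by
  have hdm : d G ≤ m G := d_le m_mem
  by_contra hne
  have hW : ∀ x ∈ V G, ∀ u ∈ Set.Icc (d G) (m G), ∃ X, IsMinGenSet G X ∧ X.ncard = u ∧ x ∈ X ∧
      1 < u := fun x hx u hu => exists_of_mem_VOfSize (Set.mem_iInter₂.1 (h ▸ hx) u hu)
  have hd : 1 < d G := by
    rcases Nat.lt_or_ge 1 (m G) with hm | hm
    · obtain ⟨X, hX, hfin, hXm⟩ := m_mem (G := G)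
      obtain ⟨x, hx, y, hy, hxy⟩ := (Set.one_lt_ncard hfin).1 (hXm ▸ hm)
      obtain ⟨-, -, -, -, h1⟩ := hW x (mem_V_iff.2 ⟨X, hX, hx, y, hy, hxy⟩) (d G) ⟨le_rfl, hdm⟩
      exact h1
    · -- Otherwise the empty set generates `G`, and it is the only minimal generating set.
      obtain ⟨X, hX, hfin, hXd⟩ := d_mem (G := G)
      obtain ⟨X', hX', hfin', hXm⟩ := m_mem (G := G)
      have hX0 : X = ∅ := (Set.ncard_eq_zero hfin).1 (by omega)
      have hne' : X'.Nonempty := Set.nonempty_of_ncard_ne_zero (by omega)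
      exact absurd (hX0 ▸ hX.1) (hX'.2 ∅ (Set.empty_ssubset.2 hne'))
  have hQ : ∀ u ∈ Set.Icc (d G) (m G), ∀ x : G ⧸ frattini G, x ≠ 1 →
      ∃ X, IsMinGenSet (G ⧸ frattini G) X ∧ x ∈ X ∧ X.ncard = u := by
    intro u hu x hx
    obtain ⟨g, rfl⟩ := QuotientGroup.mk'_surjective (frattini G) x
    have hg : g ∉ frattini G := fun hg => hx ((QuotientGroup.eq_one_iff g).2 hg)
    obtain ⟨X, hX, hXu, hgX, -⟩ := hW g (mem_V_of_notMem_frattini hd hg) u hu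
    exact ⟨_, hX.image_frattini.1, ⟨g, hgX, rfl⟩, hX.image_frattini.2.trans hXu⟩
  have hdQ : d (G ⧸ frattini G) = d G := congrArg sInf minGenSizes_quotient_frattini
  have hmQ : m (G ⧸ frattini G) = m G := congrArg sSup minGenSizes_quotient_frattini
  refine hne (hdQ ▸ hmQ ▸ d_eq_m_of_frattini_eq_bot frattini_quotient_frattini ?_ ?_)
  · rw [hdQ]
    exact hQ _ ⟨le_rfl, hdm⟩
  · rw [hmQ]
    exact hQ _ ⟨hdm, le_rfl⟩

end IndependenceGraph

theorem mainTheorem4 (G : Type*) [Group G] [Finite G] [Group.IsSolvable G]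
    (h : IndependenceGraph.V G = IndependenceGraph.W G) :
    IndependenceGraph.d G = IndependenceGraph.m G :=
  IndependenceGraph.d_eq_m_of_V_eq_W h
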